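/- Let $p$ be a prime, $n\ge 1$ an integer and $s>n-1$ a real number. For a variety $X$ over $\mathbf F_p$ let $Z^{HW}(X,t)=\exp\big(\sum_{m\ge1}\mathrm{card}\,X(\mathbf F_{p^m})\,t^m/m\big)$ be its Hasse--Weil zeta function, and let $S(X,s)=-\sum_\alpha P(\alpha)\log P(\alpha)$ be the Shannon entropy of the weights $P(\alpha)=p^{-s\deg\alpha}/Z^{HW}(X,p^{-s})$ on the effective zero-cycles $\alpha$ of $X$. Call a matrix $M\in M_{n\times n}(\mathbf Z)$ reduced if it is lower triangular with $M_{jj}\ge 0$ for all $j$ and $0\le M_{ij}<M_{jj}$ for $i>j$, and let $D_k$ be the number of reduced $n\times n$ matrices of determinant $p^k$. Then every $D_k$ is finite, the system with energy levels $\{k\log p\}_{k\ge0}$ and degeneracies $D_k$ has a convergent partition function $$Z(s)=\sum_{k\ge 0}D_k\,p^{-sk}=\prod_{\ell=0}^{n-1}\frac1{1-p^{\ell-s}}=Z^{HW}(\mathbf P^{n-1}_{\mathbf F_p},p^{-s}),$$ the weights $P(\alpha)$ for $X=\mathbf P^{n-1}_{\mathbf F_p}$ form a probability distribution, $\log Z$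 is differentiable at $s$, the series defining $S(\mathbf P^{n-1}_{\mathbf F_p},s)$ converges, and this entropy is the thermodynamic entropy of the system at inverse temperature $s$: $$S(\mathbf P^{n-1}_{\mathbf F_p},s)=\Big(1-s\frac{d}{ds}\Big)\log Z(s).$$ -/

import Mathlib

open CategoryTheory AlgebraicGeometry

noncomputable section

namespace ZetaEntropy

/-! ### Zero-cycles, Hasse-Weil zeta function and Shannon entropy over `𝔽_p` -/

section Scheme

variable {p : ℕ} [Fact p.Prime] {X : Scheme.{0}}

/-- The closed points of a scheme. -/
abbrev ClosedPoint (X : Scheme.{0}) : Type := {x : X // IsClosed ({x} : Set X)}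

/-- Effective zero-cycles on `X`: finite formal sums of closed points with coefficients in `ℕ`. -/
abbrev EffectiveZeroCycle (X : Scheme.{0}) : Type := ClosedPoint X →₀ ℕ

/-- The degree `∑ₓ aₓ [κ(x) : 𝔽_p]` of an effective zero-cycle `∑ₓ aₓ x` on `X / 𝔽_p`. -/
def cycleDegree (π : X ⟶ Spec (.of (ZMod p))) (α : EffectiveZeroCycle X) : ℕ :=
  α.sum fun x a => a * π.residueDegree x.1

/-- The set `X(𝔽_{p^m})` of points of `X / 𝔽_p` with values in the field with `p ^ m` elements
(for `m ≥ 1`): the morphisms `Spec 𝔽_{p^m} ⟶ X` over `𝔽_p`. -/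
def RationalPoint (π : X ⟶ Spec (.of (ZMod p))) (m : ℕ) : Type :=
  {g : Spec (.of (GaloisField p m)) ⟶ X //
    g ≫ π = Spec.map (CommRingCat.ofHom (algebraMap (ZMod p) (GaloisField p m)))}

/-- The Hasse-Weil zeta function `Z(X, t) = exp (∑_{m ≥ 1} #X(𝔽_{p^m}) t ^ m / m)`. -/
def hasseWeilZeta (π : X ⟶ Spec (.of (ZMod p))) (t : ℝ) : ℝ :=
  Real.exp (∑' m : ℕ, (Nat.card (RationalPoint π (m + 1)) : ℝ) * t ^ (m + 1) / ((m : ℝ) + 1))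

/-- The weight `P(α) = t ^ deg α / Z(X, t)`, for `t = p ^ (-s)`, of an effective zero-cycle. -/
def cycleProb (π : X ⟶ Spec (.of (ZMod p))) (s : ℝ) (α : EffectiveZeroCycle X) : ℝ :=
  ((p : ℝ) ^ (-s)) ^ cycleDegree π α / hasseWeilZeta π ((p : ℝ) ^ (-s))

/-- The Shannon entropy `S(X, s) = -∑_α P(α) log P(α)`, the sum over effective zero-cycles. -/
def shannonEntropy (π : X ⟶ Spec (.of (ZMod p))) (s : ℝ) : ℝ :=
  -∑' α : EffectiveZeroCycle X, cycleProb π s α * Real.log (cycleProb π s α)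

end Scheme

/-! ### Projective space -/

section ProjectiveSpace

attribute [local instance] MvPolynomial.gradedAlgebra

/-- Projective space `ℙ^{n-1}` over a field `k`, as `Proj k[X_1, …, X_n]`. -/
def projectiveSpace (n : ℕ) (k : Type) [Field k] : Scheme.{0} :=
  Proj (MvPolynomial.homogeneousSubmodule (Fin n) k)

/-- The structure morphism `ℙ^{n-1}_k ⟶ Spec k`. -/
def projectiveSpaceStr (n : ℕ) (k : Type) [Field k] : projectiveSpace n k ⟶ Spec (.of k) :=
  Proj.toSpecZero (MvPolynomial.homogeneousSubmodule (Fin n) k) ≫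
    Spec.map (CommRingCat.ofHom
      (algebraMap k (MvPolynomial.homogeneousSubmodule (Fin n) k 0)))

end ProjectiveSpace

/-! ### Thermodynamics of a system with energy levels `E k` of degeneracy `D k` -/

/-- The partition function `Z(β) = Tr e^{-βH} = ∑ₖ D k * exp (-β E k)`. -/
def partitionFunction (E : ℕ → ℝ) (D : ℕ → ℕ) (β : ℝ) : ℝ :=
  ∑' k : ℕ, (D k : ℝ) * Real.exp (-(β * E k))

/-- The thermodynamic entropy `(1 - β d/dβ) log Z(β)`. -/
def thermoEntropy (E : ℕ → ℝ) (D : ℕ → ℕ) (β : ℝ) : ℝ :=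
  Real.log (partitionFunction E D β) -
    β * deriv (fun b => Real.log (partitionFunction E D b)) β

/-! ### Reduced matrices -/

/-- Reduced `n × n` integer matrices of determinant `m`: lower triangular, with non-negative
diagonal, and `0 ≤ M i j < M j j` below the diagonal. -/
def reducedMatrices (n : ℕ) (m : ℤ) : Set (Matrix (Fin n) (Fin n) ℤ) :=
  {M | (∀ i j, i < j → M i j = 0) ∧ (∀ j, 0 ≤ M j j) ∧
    (∀ i j, j < i → 0 ≤ M i j ∧ M i j < M j j) ∧ M.det = m}

/-- The energy levels `k log p`. -/
def level (p k : ℕ) : ℝ := k * Real.log p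

/-- The degeneracies `D_k`: the number of reduced matrices of determinant `p ^ k`. -/
def degeneracy (n p k : ℕ) : ℕ := (reducedMatrices n ((p : ℤ) ^ k)).ncard

end ZetaEntropy

end

/-! Everything reduces to one function, Z(s) = ∏_{l<n} (1 - p^{l-s})⁻¹, which arises in three ways.

Matrices: a reduced matrix with diagonal (p^{a_j}) has free entries below the diagonal, giving ∏
p^{a_j(n-1-j)} choices, so the generating series is a product of geometric series
(`hasSum_degeneracy_mul_pow`). Points: ℙ^{n-1} has ∑_{l<n} p^{ml} points over 𝔽_{p^m}
(`natCard_rationalPoint_projectiveSpace`), so the Hasse-Weil exponent is a sum of logarithmic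
series. Cycles: an 𝔽_{p^m}-point is a closed point of degree d ∣ m with one of d embeddings of its
residue field (`hasSum_residueDegree`). This yields the Euler product, hence Z(s) = ∑_α p^{-s deg α}
(`hasSum_pow_degree`).

Thus P is the Gibbs distribution for the energy deg α · log p. Since -log P(α) = s · deg α · log p +
log Z, its mean is s⟨energy⟩ + log Z, and termwise differentiation (`exists_hasDerivAt_of_hasSum`)
gives ⟨energy⟩ = -(log Z)'. -/

namespace ZetaEntropy

/-! ### Euler products. -/

/-- A finite product of geometric series. -/
theorem hasSum_pi_geometric {κ : Type*} [Fintype κ] (f : κ → ℝ) (h0 : ∀ x, 0 ≤ f x)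
    (h1 : ∀ x, f x < 1) :
    HasSum (fun a : κ → ℕ => ∏ x, f x ^ a x) (∏ x, (1 - f x)⁻¹) := by
  classical
  refine Fintype.induction_empty_option (P := fun κ _ => ∀ f : κ → ℝ, (∀ x, 0 ≤ f x) →
    (∀ x, f x < 1) → HasSum (fun a : κ → ℕ => ∏ x, f x ^ a x) (∏ x, (1 - f x)⁻¹))
    ?_ ?_ ?_ κ f h0 h1
  · intro α β _ e ih f h0 h1
    let := Fintype.ofEquiv β e.symm
    have := ih (fun x => f (e x)) (fun x => h0 _) (fun x => h1 _)
    rw [← (Equiv.arrowCongr e (Equiv.refl ℕ)).symm.hasSum_iff] at this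
    convert this using 1
    · funext a
      simp only [Function.comp_apply]
      rw [← e.prod_comp]
      simp
    · rw [← e.prod_comp]
  · intro f _ _
    convert hasSum_unique (fun a : PEmpty → ℕ => ∏ x, f x ^ a x) using 1
    simp
  · intro α _ ih f h0 h1
    have := ih (fun x => f (some x)) (fun x => h0 _) (fun x => h1 _)
    have hg := hasSum_geometric_of_lt_one (h0 none) (h1 none)
    have hm := hg.mul this (hg.summable.mul_of_nonneg this.summable
      (fun n => pow_nonneg (h0 none) n)
      (fun a => Finset.prod_nonneg fun x _ => pow_nonneg (h0 _) _))
    have he : (fun a : Option α → ℕ => ∏ x, f x ^ a x) =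
        (fun y : ℕ × (α → ℕ) => f none ^ y.1 * ∏ x, f (some x) ^ y.2 x) ∘
          (Equiv.piOptionEquivProd (β := fun _ => ℕ)) := by
      funext a
      simp [Fintype.prod_option, Equiv.piOptionEquivProd]
    rw [he, Fintype.prod_option, Equiv.hasSum_iff]
    exact hm

/-- The Euler product over finitely supported exponent vectors. -/
theorem hasSum_finsupp_geometric {ι : Type*} (f : ι → ℝ) (h0 : ∀ x, 0 ≤ f x)
    (h1 : ∀ x, f x < 1) {L : ℝ} (hL : HasProd (fun x => (1 - f x)⁻¹) L) :
    HasSum (fun α : ι →₀ ℕ => α.prod fun x k => f x ^ k) L := by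
  classical
  have hge (x) : 1 ≤ (1 - f x)⁻¹ :=
    (one_le_inv₀ (sub_pos.2 (h1 x))).2 (by linarith [h0 x])
  have hnn (α : ι →₀ ℕ) : 0 ≤ α.prod fun x k => f x ^ k :=
    Finset.prod_nonneg fun x _ => pow_nonneg (h0 _) _
  have key (S : Finset ι) :
      HasSum (fun α : {α : ι →₀ ℕ // (α.support : Set ι) ⊆ S} => α.1.prod fun x k => f x ^ k)
        (∏ x ∈ S, (1 - f x)⁻¹) := by
    have := hasSum_pi_geometric (fun x : (S : Set ι) => f x) (fun x => h0 _) (fun x => h1 _)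
    rw [← Finsupp.equivFunOnFinite.hasSum_iff,
      ← (Finsupp.restrictSupportEquiv (S : Set ι) ℕ).hasSum_iff] at this
    convert this using 1
    · funext α
      obtain ⟨α, hα⟩ := α
      simp only [Function.comp_apply, Finsupp.equivFunOnFinite_apply]
      rw [Finsupp.prod_of_support_subset α (s := S) (by simpa using hα) _ (by simp)]
      exact (Finset.prod_coe_sort S fun x => f x ^ α x).symm
    · exact (Finset.prod_coe_sort S fun x => (1 - f x)⁻¹).symm
  -- With nonnegative terms, L need only be the supremum of the finite sums. A finite sum involves
  -- finitely many indices S, so it is at most the product over S, which is at most L because all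
  -- factors are ≥ 1. Conversely, each such product is a limit of finite sums.
  apply hasSum_of_isLUB_of_nonneg _ hnn
  constructor
  · rintro _ ⟨A, rfl⟩
    let S : Finset ι := A.biUnion fun α => α.support
    have hA : ∀ α ∈ A, (α.support : Set ι) ⊆ S := fun α hα =>
      Finset.coe_subset.2 (Finset.subset_biUnion_of_mem (fun α : ι →₀ ℕ => α.support) hα)
    have h2 := sum_le_hasSum (A.subtype fun α => (α.support : Set ι) ⊆ S)
      (fun α _ => hnn α.1) (key S)
    rw [Finset.sum_subtype_of_mem (fun α : ι →₀ ℕ => α.prod fun x k => f x ^ k) hA] at h2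
    refine h2.trans ?_
    refine ge_of_tendsto hL ?_
    filter_upwards [Filter.eventually_ge_atTop S] with T hT
    exact Finset.prod_le_prod_of_subset_of_one_le hT
      (fun x _ => zero_le_one.trans (hge x)) (fun x _ _ => hge x)
  · intro B hB
    refine le_of_tendsto hL (Filter.Eventually.of_forall fun S => ?_)
    refine le_of_tendsto (key S) (Filter.Eventually.of_forall fun A => ?_)
    refine le_trans (le_of_eq ?_) (hB ⟨A.map (Function.Embedding.subtype _), rfl⟩)
    simp

/-- The logarithm of an Euler product, arranged by the powers of the variable. -/
theorem hasSum_neg_log_one_sub_pow {ι : Type*} (d : ι → ℕ) (hd : ∀ x, 0 < d x) (N : ℕ → ℕ)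
    (hN : ∀ m, 0 < m → HasSum (fun x => if d x ∣ m then (d x : ℝ) else 0) (N m))
    {t : ℝ} (ht0 : 0 ≤ t) (ht1 : t < 1) {L : ℝ}
    (hL : HasSum (fun m : ℕ => (N (m + 1) : ℝ) * t ^ (m + 1) / ((m : ℝ) + 1)) L) :
    HasSum (fun x => -Real.log (1 - t ^ d x)) L := by
  -- A nonnegative double series, with the index m standing for the exponent m + 1. Summing over x
  -- first gives the point-count series; summing over m first gives the logarithm of each Euler
  -- factor.
  let F : (Σ _ : ℕ, ι) → ℝ := fun y =>
    if d y.2 ∣ y.1 + 1 then (d y.2 : ℝ) * (t ^ (y.1 + 1) / ((y.1 : ℝ) + 1)) else 0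
  have hF0 (y) : 0 ≤ F y := by
    simp only [F]; split_ifs <;> positivity
  have hrow (m : ℕ) : HasSum (fun x => F ⟨m, x⟩) ((N (m + 1) : ℝ) * t ^ (m + 1) / ((m : ℝ) + 1)) := by
    have := (hN (m + 1) m.succ_pos).mul_right (t ^ (m + 1) / ((m : ℝ) + 1))
    have hF : (fun x => F ⟨m, x⟩) =
        fun x => (if d x ∣ m + 1 then (d x : ℝ) else 0) * (t ^ (m + 1) / ((m : ℝ) + 1)) := by
      funext x
      simp only [F]
      split_ifs <;> simp
    rw [hF, mul_div_assoc]
    exact this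
  have hFs : Summable F := by
    rw [summable_sigma_of_nonneg hF0]
    refine ⟨fun m => (hrow m).summable, ?_⟩
    simp_rw [(hrow _).tsum_eq]
    exact hL.summable
  have hF : HasSum F L := by
    have := hFs.hasSum.sigma hrow
    rw [hL.unique this]
    exact hFs.hasSum
  let e : (Σ _ : ι, ℕ) ≃ (Σ _ : ℕ, ι) :=
    (Equiv.sigmaEquivProd ι ℕ).trans ((Equiv.prodComm ι ℕ).trans (Equiv.sigmaEquivProd ℕ ι).symm)
  have hF' : HasSum (F ∘ e) L := e.hasSum_iff.2 hF
  refine hF'.sigma fun x => ?_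
  have htd : |t ^ d x| < 1 := by
    rw [abs_of_nonneg (by positivity)]
    exact pow_lt_one₀ ht0 ht1 (hd x).ne'
  have hlog := Real.hasSum_pow_div_log_of_abs_lt_one htd
  -- Only the exponents divisible by d x contribute; after the index shift these are m = d x * (k +
  -- 1) - 1.
  let g : ℕ → ℕ := fun k => d x * (k + 1) - 1
  have hg1 (k) : g k + 1 = d x * (k + 1) :=
    Nat.sub_add_cancel (Nat.mul_pos (hd x) k.succ_pos)
  have hgi : Function.Injective g := fun a b h => by
    have h1 := hg1 a
    rw [h, hg1 b] at h1
    have := Nat.eq_of_mul_eq_mul_left (hd x) h1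
    omega
  rw [← hgi.hasSum_iff]
  · convert hlog using 1
    funext k
    have hdx : (d x : ℝ) ≠ 0 := by exact_mod_cast (hd x).ne'
    have hc : ((g k : ℕ) : ℝ) + 1 = d x * (k + 1) := by exact_mod_cast hg1 k
    have : (F ∘ e) ⟨x, g k⟩ = (d x : ℝ) * (t ^ (g k + 1) / ((g k : ℝ) + 1)) :=
      if_pos (hg1 k ▸ dvd_mul_right _ _)
    simp only [Function.comp_apply] at this ⊢
    rw [this, hc, hg1, pow_mul]
    field_simp
  · intro m hm
    refine if_neg fun h => hm ?_
    obtain ⟨c, hc⟩ := h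
    change m + 1 = d x * c at hc
    have hc0 : c ≠ 0 := by rintro rfl; simp at hc
    obtain ⟨k, rfl⟩ := Nat.exists_eq_succ_of_ne_zero hc0
    exact ⟨k, by have := hg1 k; simp only [Nat.succ_eq_add_one] at hc; omega⟩

/-- The Euler product of a zeta function defined by counting points. -/
theorem hasSum_pow_degree {ι : Type*} (d : ι → ℕ) (hd : ∀ x, 0 < d x) (N : ℕ → ℕ)
    (hN : ∀ m, 0 < m → HasSum (fun x => if d x ∣ m then (d x : ℝ) else 0) (N m))
    {t : ℝ} (ht0 : 0 ≤ t) (ht1 : t < 1) {L : ℝ}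
    (hL : HasSum (fun m : ℕ => (N (m + 1) : ℝ) * t ^ (m + 1) / ((m : ℝ) + 1)) L) :
    HasSum (fun α : ι →₀ ℕ => t ^ (α.sum fun x a => a * d x)) (Real.exp L) := by
  have h1 (x) : t ^ d x < 1 := pow_lt_one₀ ht0 ht1 (hd x).ne'
  have h := (hasSum_neg_log_one_sub_pow d hd N hN ht0 ht1 hL).rexp
  have h2 := hasSum_finsupp_geometric (fun x => t ^ d x) (fun x => by positivity) h1 (L := Real.exp L)
    (by
      convert h using 1
      funext x
      simp [Real.exp_neg, Real.exp_log (sub_pos.2 (h1 x))])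
  convert h2 using 1
  funext α
  rw [Finsupp.sum, Finsupp.prod, ← Finset.prod_pow_eq_pow_sum]
  refine Finset.prod_congr rfl fun x _ => ?_
  rw [← pow_mul, mul_comm]

end ZetaEntropy

/-! ### Counting reduced matrices. -/

noncomputable section

namespace ZetaEntropy

/-- The possible entries of a reduced matrix with diagonal `(b₁, …, bₙ)`. -/
def reducedEntries {n : ℕ} (b : Fin n → ℕ) (i j : Fin n) : Finset ℤ :=
  if i < j then {0} else if i = j then {(b j : ℤ)} else Finset.Ico 0 (b j : ℤ)

/-- The reduced matrices with diagonal `(b₁, …, bₙ)`. -/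
def reducedWithDiag {n : ℕ} (b : Fin n → ℕ) : Finset (Matrix (Fin n) (Fin n) ℤ) :=
  Fintype.piFinset fun i => Fintype.piFinset fun j => reducedEntries b i j

theorem mem_reducedWithDiag {n : ℕ} {b : Fin n → ℕ} {M : Matrix (Fin n) (Fin n) ℤ} :
    M ∈ reducedWithDiag b ↔ ∀ i j, M i j ∈ reducedEntries b i j :=
  Fintype.mem_piFinset.trans (forall_congr' fun _ => Fintype.mem_piFinset)

theorem mem_reducedWithDiag_iff {n : ℕ} {b : Fin n → ℕ} {M : Matrix (Fin n) (Fin n) ℤ} :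
    M ∈ reducedWithDiag b ↔ (∀ i j, i < j → M i j = 0) ∧ (∀ j, M j j = b j) ∧
      (∀ i j, j < i → 0 ≤ M i j ∧ M i j < b j) := by
  rw [mem_reducedWithDiag]
  constructor
  · intro h
    refine ⟨fun i j hij => ?_, fun j => ?_, fun i j hij => ?_⟩
    · simpa [reducedEntries, hij] using h i j
    · simpa [reducedEntries] using h j j
    · simpa [reducedEntries, hij.not_gt, hij.ne'] using h i j
  · rintro ⟨h1, h2, h3⟩ i j
    rcases lt_trichotomy i j with hij | rfl | hij
    · simp [reducedEntries, hij, h1 i j hij]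
    · simp [reducedEntries, h2]
    · simpa [reducedEntries, hij.not_gt, hij.ne'] using h3 i j hij

/-- Column j has n - 1 - j entries below the diagonal, each with b j possible values. -/
theorem card_reducedWithDiag {n : ℕ} (b : Fin n → ℕ) :
    (reducedWithDiag b).card = ∏ j : Fin n, b j ^ (n - 1 - j : ℕ) := by
  refine (Fintype.card_piFinset _).trans ?_
  simp_rw [Fintype.card_piFinset]
  rw [Finset.prod_comm]
  refine Finset.prod_congr rfl fun j _ => ?_
  have (i : Fin n) : (reducedEntries b i j).card = if j < i then b j else 1 := by
    rcases lt_trichotomy i j with hij | rfl | hij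
    · simp [reducedEntries, hij, hij.not_gt]
    · simp [reducedEntries]
    · simp [reducedEntries, hij, hij.not_gt, hij.ne']
  simp_rw [this]
  rw [Finset.prod_ite]
  have h : (Finset.univ.filter fun i => j < i) = Finset.Ioi j := by ext; simp
  simp [h, Fin.card_Ioi]

/-- The determinant is the product of the diagonal, so each nonnegative diagonal entry divides p ^ k
and is a power of p; the exponents add up to k. -/
theorem reducedMatrices_eq_biUnion (p : ℕ) [hp : Fact p.Prime] (n k : ℕ) :
    reducedMatrices n ((p : ℤ) ^ k) =
      ((Finset.piAntidiag Finset.univ k).biUnion fun a : Fin n → ℕ =>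
        reducedWithDiag fun j => p ^ a j : Finset (Matrix (Fin n) (Fin n) ℤ)) := by
  ext M
  simp only [reducedMatrices, Set.mem_ofPred_eq, Finset.coe_biUnion, Set.mem_iUnion,
    Finset.mem_coe, Finset.mem_piAntidiag, mem_reducedWithDiag_iff, exists_prop]
  have hdet (h : ∀ i j, i < j → M i j = 0) : M.det = ∏ i, M i i :=
    Matrix.det_of_isLowerTriangular M fun i j hij => h i j hij
  constructor
  · rintro ⟨h1, h2, h3, h4⟩
    rw [hdet h1] at h4
    have hdvd (j) : ∃ a : ℕ, M j j = (p : ℤ) ^ a := by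
      have : M j j ∣ (p : ℤ) ^ k := h4 ▸ Finset.dvd_prod_of_mem _ (Finset.mem_univ j)
      have h5 : (M j j).natAbs ∣ p ^ k := by
        simpa [Int.natAbs_pow] using Int.natAbs_dvd_natAbs.2 this
      obtain ⟨a, -, ha⟩ := (Nat.dvd_prime_pow hp.out).1 h5
      exact ⟨a, by rw [← Int.natAbs_of_nonneg (h2 j), ha]; simp⟩
    choose a ha using hdvd
    refine ⟨a, ⟨?_, by simp⟩, h1, fun j => by simp [ha], fun i j hij => ?_⟩
    · simp_rw [ha, Finset.prod_pow_eq_pow_sum] at h4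
      have h6 : p ^ (∑ i, a i) = p ^ k := by exact_mod_cast h4
      exact Nat.pow_right_injective hp.out.two_le h6
    · have := h3 i j hij
      rw [ha j] at this
      exact_mod_cast this
  · rintro ⟨a, ⟨ha, -⟩, h1, h2, h3⟩
    refine ⟨h1, fun j => by rw [h2]; positivity, fun i j hij => by rw [h2]; exact h3 i j hij, ?_⟩
    rw [hdet h1]
    simp_rw [h2]
    push_cast
    rw [Finset.prod_pow_eq_pow_sum, ha]

theorem degeneracy_eq_sum (p : ℕ) [hp : Fact p.Prime] (n k : ℕ) :
    degeneracy n p k =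
      ∑ a ∈ Finset.piAntidiag (Finset.univ : Finset (Fin n)) k,
        ∏ j : Fin n, (p ^ a j) ^ (n - 1 - j : ℕ) := by
  classical
  rw [degeneracy, reducedMatrices_eq_biUnion, Set.ncard_coe_finset, Finset.card_biUnion]
  · simp_rw [card_reducedWithDiag]
  · intro a _ b _ hab
    rw [Function.onFun, Finset.disjoint_left]
    intro M hM hM'
    rw [mem_reducedWithDiag_iff] at hM hM'
    refine hab (funext fun j => Nat.pow_right_injective hp.out.two_le ?_)
    have := (hM.2.1 j).symm.trans (hM'.2.1 j)
    exact_mod_cast this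

/-- The generating series of the number of reduced matrices of determinant `p ^ k`. -/
theorem hasSum_degeneracy_mul_pow (p : ℕ) [hp : Fact p.Prime] (n : ℕ) {x : ℝ} (hx : 0 ≤ x)
    (h : ∀ l < n, (p : ℝ) ^ l * x < 1) :
    HasSum (fun k => (degeneracy n p k : ℝ) * x ^ k)
      (∏ l ∈ Finset.range n, (1 - (p : ℝ) ^ l * x)⁻¹) := by
  classical
  have h1 (j : Fin n) : (p : ℝ) ^ (n - 1 - j : ℕ) * x < 1 := h _ (by have := j.2; omega)
  have hs := hasSum_pi_geometric (fun j : Fin n => (p : ℝ) ^ (n - 1 - j : ℕ) * x)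
    (fun j => by positivity) h1
  have hprod : ∏ j : Fin n, (1 - (p : ℝ) ^ (n - 1 - j : ℕ) * x)⁻¹ =
      ∏ l ∈ Finset.range n, (1 - (p : ℝ) ^ l * x)⁻¹ := by
    rw [Fin.prod_univ_eq_prod_range fun j : ℕ => (1 - (p : ℝ) ^ (n - 1 - j) * x)⁻¹,
      Finset.prod_range_reflect fun j => (1 - (p : ℝ) ^ j * x)⁻¹]
  rw [hprod] at hs
  -- Exponent vectors are regrouped by their total, which is both the power of x and the exponent of
  -- the determinant.
  rw [← (Equiv.sigmaFiberEquiv fun a : Fin n → ℕ => ∑ j, a j).hasSum_iff] at hs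
  refine hs.sigma fun k => ?_
  have hmem : ∀ a : Fin n → ℕ, a ∈ Finset.piAntidiag (Finset.univ : Finset (Fin n)) k ↔
      ∑ j, a j = k := fun a => by simp
  have : Fintype {a : Fin n → ℕ // ∑ j, a j = k} := Fintype.subtype _ hmem
  convert hasSum_fintype (fun c : {a : Fin n → ℕ // ∑ j, a j = k} =>
    ((fun a : Fin n → ℕ => ∏ j : Fin n, ((p : ℝ) ^ (n - 1 - j : ℕ) * x) ^ a j) ∘
      (Equiv.sigmaFiberEquiv fun a : Fin n → ℕ => ∑ j, a j)) ⟨k, c⟩) using 1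
  rw [degeneracy_eq_sum, Nat.cast_sum, Finset.sum_mul, Finset.sum_subtype _ hmem]
  refine Finset.sum_congr rfl fun a _ => ?_
  simp only [Function.comp_apply, Equiv.sigmaFiberEquiv, Equiv.coe_fn_mk, mul_pow,
    Finset.prod_mul_distrib, Finset.prod_pow_eq_pow_sum, a.2]
  push_cast
  congr 1
  exact Finset.prod_congr rfl fun j _ => by rw [← pow_mul, ← pow_mul, mul_comm]

end ZetaEntropy

end

/-! ### Closed points and points with values in finite fields. -/

noncomputable section

namespace ZetaEntropy

/-- Ring homomorphisms are automatically 𝔽_p-linear, and 𝔽_{p^d} embeds in 𝔽_{p^m} exactly when d ∣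
m, then in d ways. -/
theorem natCard_ringHom_galoisField (p : ℕ) [Fact p.Prime] (K : Type*) [Field K] [Finite K]
    [CharP K p] (d m : ℕ) (hd : Nat.card K = p ^ d) (hm : m ≠ 0) :
    Nat.card (K →+* GaloisField p m) = if d ∣ m then d else 0 := by
  let : Algebra (ZMod p) K := ZMod.algebra K p
  have hfin : Module.finrank (ZMod p) K = d := by
    have := Module.natCard_eq_pow_finrank (K := ZMod p) (V := K)
    rw [hd, Nat.card_zmod] at this
    exact (Nat.pow_right_injective (Fact.out : p.Prime).two_le this).symm
  have hfin' : Module.finrank (ZMod p) (GaloisField p m) = m := GaloisField.finrank p hm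
  let e : (K →+* GaloisField p m) ≃ (K →ₐ[ZMod p] GaloisField p m) :=
    { toFun f := AlgHom.mk f fun r =>
        congr($(Subsingleton.elim (f.comp (algebraMap (ZMod p) K)) (algebraMap (ZMod p) _)) r)
      invFun f := f
      left_inv _ := rfl
      right_inv _ := rfl }
  rw [Nat.card_congr e]
  split_ifs with h
  · rw [FiniteField.natCard_algHom_of_finrank_dvd (by rwa [hfin, hfin']), hfin]
  · have : IsEmpty (K →ₐ[ZMod p] GaloisField p m) := by
      rw [← not_nonempty_iff, FiniteField.nonempty_algHom_iff_finrank_dvd, hfin, hfin']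
      exact h
    exact Nat.card_of_isEmpty

section

variable {p : ℕ} [hp : Fact p.Prime] {X : Scheme.{0}} (π : X ⟶ Spec (.of (ZMod p)))

theorem bijective_algebraMap_residueField_of_isField {K : Type*} [CommRing K] (hK : IsField K)
    (I : Ideal K) [hI : I.IsPrime] : Function.Bijective (algebraMap K I.ResidueField) := by
  let := hK.toField
  have hI' : I.IsMaximal := by
    rw [(Ideal.eq_bot_or_top I).resolve_right hI.ne_top]
    exact Ideal.bot_isMaximal
  exact ⟨RingHom.injective _, Ideal.algebraMap_residueField_surjective I⟩

theorem natCard_residueField_of_isField {R : CommRingCat.{0}} (hR : IsField R) (y : Spec R) :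
    Nat.card ((Spec R).residueField y) = Nat.card R := by
  have h := bijective_algebraMap_residueField_of_isField hR y.asIdeal (hI := y.isPrime)
  exact (Nat.card_congr (Scheme.Spec.residueFieldIso R y).commRingCatIsoToRingEquiv.toEquiv).trans
    (Nat.card_congr (Equiv.ofBijective _ h)).symm

/-- `residueDegree` is a degree over the residue field of the image point in Spec 𝔽_p, which
therefore has to be compared with 𝔽_p itself. -/
theorem natCard_residueField_spec_zmod (y : Spec (.of (ZMod p))) :
    Nat.card ((Spec (.of (ZMod p))).residueField y) = p :=
  (natCard_residueField_of_isField (R := .of (ZMod p)) (Field.toIsField (ZMod p)) y).trans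
    (Nat.card_zmod p)

/-- Any morphism from the spectrum of `𝔽_{p^m}` is a morphism over `𝔽_p`. -/
def rationalPointEquiv (m : ℕ) :
    RationalPoint π m ≃ (Σ x : X, X.residueField x ⟶ .of (GaloisField p m)) :=
  (Equiv.subtypeUnivEquiv fun g => by
    rw [← Spec.map_preimage (g ≫ π)]
    congr 1
    ext1
    exact Subsingleton.elim (α := ZMod p →+* GaloisField p m) _ _).trans
    (Scheme.SpecToEquivOfField (GaloisField p m) X)

variable [LocallyOfFiniteType π]

include π in
-- A form of the Nullstellensatz: at a closed point, Spec κ(x) → Spec 𝔽_p is a closed immersion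
-- followed by a morphism locally of finite type, hence finite.
theorem finite_residueField {x : X} (hx : IsClosed ({x} : Set X)) :
    Finite (X.residueField x) := by
  have := LocallyOfFiniteType.jacobsonSpace π
  have h : IsFinite (X.fromSpecResidueField x ≫ π) := by
    rw [isClosed_singleton_iff_isClosedImmersion] at hx
    rw [isFinite_iff_locallyOfFiniteType_of_jacobsonSpace]
    infer_instance
  rw [← Spec.map_preimage (X.fromSpecResidueField x ≫ π), IsFinite.SpecMap_iff] at h
  let φ : ZMod p →+* X.residueField x := (Spec.preimage (X.fromSpecResidueField x ≫ π)).hom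
  let := φ.toAlgebra
  have : Module.Finite (ZMod p) (X.residueField x) := h
  exact Module.finite_of_finite (ZMod p)

include π in
-- Ensures that the image of an 𝔽_{p^m}-point is closed: if κ(x) is finite, then Spec κ(x) → X is
-- locally of finite type, which on a Jacobson scheme forces x to be closed.
theorem isClosed_singleton_of_finite {x : X} (hx : Finite (X.residueField x)) :
    IsClosed ({x} : Set X) := by
  have := LocallyOfFiniteType.jacobsonSpace π
  rw [isClosed_singleton_iff_locallyOfFiniteType]
  have h : LocallyOfFiniteType (X.fromSpecResidueField x ≫ π) := by
    rw [← Spec.map_preimage (X.fromSpecResidueField x ≫ π),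
      HasRingHomProperty.Spec_iff (P := @LocallyOfFiniteType)]
    let φ : ZMod p →+* X.residueField x := (Spec.preimage (X.fromSpecResidueField x ≫ π)).hom
    let := φ.toAlgebra
    have : Module.Finite (ZMod p) (X.residueField x) := inferInstance
    exact (inferInstance : Algebra.FiniteType (ZMod p) (X.residueField x))
  exact locallyOfFiniteType_of_comp _ π

theorem natCard_residueField {x : X} (hx : IsClosed ({x} : Set X)) :
    Nat.card (X.residueField x) = p ^ π.residueDegree x := by
  have := finite_residueField π hx
  let := (π.residueFieldMap x).hom.toAlgebra
  rw [Module.natCard_eq_pow_finrank (K := (Spec (.of (ZMod p))).residueField (π x)),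
    natCard_residueField_spec_zmod]
  rfl

theorem residueDegree_pos {x : X} (hx : IsClosed ({x} : Set X)) : 0 < π.residueDegree x := by
  have := finite_residueField π hx
  rw [Nat.pos_iff_ne_zero]
  intro h
  have h1 := natCard_residueField π hx
  rw [h, pow_zero] at h1
  exact Finite.one_lt_card.ne' h1

theorem natCard_residueField_hom {x : X} (hx : IsClosed ({x} : Set X)) {m : ℕ} (hm : m ≠ 0) :
    Nat.card (X.residueField x ⟶ .of (GaloisField p m)) =
      if π.residueDegree x ∣ m then π.residueDegree x else 0 := by
  have := finite_residueField π hx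
  let φ : ZMod p →+* X.residueField x := (Spec.preimage (X.fromSpecResidueField x ≫ π)).hom
  have : CharP (X.residueField x) p := charP_of_injective_ringHom φ.injective p
  rw [← natCard_ringHom_galoisField p (X.residueField x) _ m (natCard_residueField π hx) hm]
  exact Nat.card_congr
    ⟨fun f => f.hom, fun f => CommRingCat.ofHom f, fun _ => rfl, fun _ => rfl⟩

/-- Points with values in a finite field are closed points with an embedding of the residue
field. -/
def rationalPointEquivClosedPoint (m : ℕ) :
    RationalPoint π m ≃ (Σ x : ClosedPoint X, X.residueField x.1 ⟶ .of (GaloisField p m)) :=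
  (rationalPointEquiv π m).trans
    { toFun y := ⟨⟨y.1, isClosed_singleton_of_finite π
        (Finite.of_injective y.2.hom (RingHom.injective _))⟩, y.2⟩
      invFun y := ⟨y.1.1, y.2⟩
      left_inv _ := rfl
      right_inv _ := rfl }

/-- A rational point over `𝔽_{p^m}` is a closed point of degree `d ∣ m` together with one of the
`d` embeddings of its residue field. -/
theorem hasSum_residueDegree {m : ℕ} (hm : m ≠ 0) (hfin : Finite (RationalPoint π m)) :
    HasSum (fun x : ClosedPoint X => if π.residueDegree x.1 ∣ m then (π.residueDegree x.1 : ℝ) else 0)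
      (Nat.card (RationalPoint π m)) := by
  have e := rationalPointEquivClosedPoint π m
  have hfin' := Finite.of_equiv _ e
  have : Fintype (Σ x : ClosedPoint X, X.residueField x.1 ⟶ .of (GaloisField p m)) :=
    Fintype.ofFinite _
  have h := (hasSum_fintype fun _ :
    (Σ x : ClosedPoint X, X.residueField x.1 ⟶ .of (GaloisField p m)) => (1 : ℝ))
  rw [Nat.card_congr e, Nat.card_eq_fintype_card]
  rw [Finset.sum_const, nsmul_one, Finset.card_univ] at h
  refine h.sigma fun x => ?_
  have : Finite (X.residueField x.1 ⟶ .of (GaloisField p m)) :=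
    Finite.of_injective (Sigma.mk (β := fun x : ClosedPoint X =>
      X.residueField x.1 ⟶ .of (GaloisField p m)) x) sigma_mk_injective
  have : Fintype (X.residueField x.1 ⟶ .of (GaloisField p m)) := Fintype.ofFinite _
  convert hasSum_fintype fun _ : X.residueField x.1 ⟶ .of (GaloisField p m) => (1 : ℝ) using 1
  rw [Finset.sum_const, nsmul_one, Finset.card_univ, ← Nat.card_eq_fintype_card,
    natCard_residueField_hom π x.2 hm]
  split_ifs <;> simp

end

end ZetaEntropy

end

/-! ### Points of projective space through its standard charts. -/

noncomputable section

namespace ZetaEntropy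

attribute [local instance] MvPolynomial.gradedAlgebra

open HomogeneousLocalization MvPolynomial

/-- Scaling the arguments of a homogeneous polynomial. -/
theorem _root_.MvPolynomial.IsHomogeneous.aeval_const_mul {σ R S : Type*} [CommSemiring R]
    [CommSemiring S] [Algebra R S] {y : MvPolynomial σ R} {m : ℕ} (hy : y.IsHomogeneous m) (u : S)
    (g : σ → S) : aeval (fun j => u * g j) y = u ^ m * aeval g y := by
  rw [aeval_def, aeval_def, eval₂_eq, eval₂_eq, Finset.mul_sum]
  refine Finset.sum_congr rfl fun d hd => ?_
  have h : d.degree = m := by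
    have := hy (mem_support_iff.1 hd)
    rw [← this, Finsupp.degree_eq_weight_one]; rfl
  simp_rw [mul_pow, Finset.prod_mul_distrib, Finset.prod_pow_eq_pow_sum]
  rw [← h, Finsupp.degree_apply]
  ring

section Away

variable {n : ℕ} {k : Type} [Field k]

/-- The coordinate ring of the standard affine chart `X_i ≠ 0` of projective space. -/
abbrev Chart (k : Type) [Field k] (i : Fin n) : Type :=
  Away (homogeneousSubmodule (Fin n) k) (X i : MvPolynomial (Fin n) k)

theorem X_mem (i : Fin n) : (X i : MvPolynomial (Fin n) k) ∈ homogeneousSubmodule (Fin n) k 1 :=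
  isHomogeneous_X k i

/-- The affine coordinate `X_j / X_i`. -/
def chartCoord (i j : Fin n) : Chart k i :=
  Away.mk (homogeneousSubmodule (Fin n) k) (X_mem i) 1 (X j) (by simpa using X_mem j)

theorem chartCoord_self (i : Fin n) : chartCoord (k := k) i i = 1 := by
  apply HomogeneousLocalization.val_injective
  rw [chartCoord, Away.val_mk, HomogeneousLocalization.val_one]
  simp only [pow_one]
  exact Localization.mk_self_mk _ _

/-- Constants in the chart. -/
def chartConst (i : Fin n) : k →+* Chart k i :=
  (fromZeroRingHom (homogeneousSubmodule (Fin n) k) _).comp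
    (algebraMap k (homogeneousSubmodule (Fin n) k 0))

/-- By homogeneity, y / X_i^m is y evaluated at the X_j / X_i. Hence the chart is generated over the
constants by its coordinates. -/
theorem eval₂Hom_chartCoord (i : Fin n) {m : ℕ} {y : MvPolynomial (Fin n) k}
    (hy : y ∈ homogeneousSubmodule (Fin n) k (m • 1)) :
    eval₂Hom (chartConst i) (chartCoord i) y =
      Away.mk (homogeneousSubmodule (Fin n) k) (X_mem i) m y hy := by
  apply HomogeneousLocalization.val_injective
  let A := Localization.Away (X i : MvPolynomial (Fin n) k)
  let u : A := Localization.mk 1 ⟨X i, Submonoid.mem_powers _⟩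
  have h1 : ((algebraMap (Chart k i) A).comp (eval₂Hom (chartConst i) (chartCoord i))) =
      (aeval (R := k) fun j => u * algebraMap (MvPolynomial (Fin n) k) A (X j)).toRingHom := by
    apply MvPolynomial.ringHom_ext
    · intro c
      simp
      rfl
    · intro j
      simp [chartCoord, Away.val_mk, u, A, ← Localization.mk_one_eq_algebraMap,
        Localization.mk_mul]
  have h2 := congr($h1 y)
  have hy' : y.IsHomogeneous m := by simpa using hy
  have h3 : aeval (R := k) (fun j => algebraMap (MvPolynomial (Fin n) k) A (X j)) y =
      algebraMap _ A y := by
    have := aeval_algebraMap_apply (R := k) A (X : Fin n → MvPolynomial (Fin n) k) y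
    rw [aeval_X_left_apply] at this
    exact this
  refine h2.trans ?_
  change aeval (R := k) (fun j => u * algebraMap (MvPolynomial (Fin n) k) A (X j)) y = _
  rw [hy'.aeval_const_mul, h3, Away.val_mk, ← Localization.mk_one_eq_algebraMap,
    Localization.mk_pow, Localization.mk_mul]
  simp

/-- Evaluation of a chart at a point with `X_i = 1`. -/
def chartEval {K : Type*} [CommRing K] [Algebra k K] (i : Fin n) (a : Fin n → K) (ha : a i = 1) :
    Chart k i →+* K :=
  (Localization.awayLift (aeval (R := k) a).toRingHom (X i) (by simp [ha])).comp
    (algebraMap (Chart k i) (Localization.Away (X i : MvPolynomial (Fin n) k)))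

theorem chartEval_chartCoord {K : Type*} [CommRing K] [Algebra k K] (i : Fin n) (a : Fin n → K)
    (ha : a i = 1) (j : Fin n) : chartEval (k := k) i a ha (chartCoord i j) = a j := by
  simp only [chartEval, RingHom.comp_apply, HomogeneousLocalization.algebraMap_apply, chartCoord,
    Away.val_mk]
  rw [Localization.mk_eq_mk', Localization.awayLift, IsLocalization.Away.lift,
    IsLocalization.lift_mk'_spec]
  simp [ha]

theorem chart_hom_ext {K : Type*} [CommRing K] [Subsingleton (k →+* K)] (i : Fin n)
    {φ ψ : Chart k i →+* K} (h : ∀ j, φ (chartCoord i j) = ψ (chartCoord i j)) : φ = ψ := by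
  have h1 : φ.comp (eval₂Hom (chartConst i) (chartCoord i)) =
      ψ.comp (eval₂Hom (chartConst i) (chartCoord i)) := by
    apply MvPolynomial.ringHom_ext
    · intro c
      simpa using congr($(Subsingleton.elim (φ.comp (chartConst i)) (ψ.comp (chartConst i))) c)
    · intro j
      simpa using h j
  ext x
  obtain ⟨m, y, hy, rfl⟩ := Away.mk_surjective _ (X_mem i) x
  rw [← eval₂Hom_chartCoord i hy]
  exact congr($h1 y)

end Away

section Points

variable {n : ℕ} {k : Type} [Field k]

/-- In the chart X_i ≠ 0 the locus X_j ≠ 0 is where X_j / X_i is invertible, and the only prime of K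
is zero. -/
theorem mem_basicOpen_iff {K : Type} [Field K] (i j : Fin n) (φ : Chart k i →+* K)
    (z : Spec (.of K)) :
    (Spec.map (CommRingCat.ofHom φ) ≫ Proj.awayι (homogeneousSubmodule (Fin n) k) (X i) (X_mem i)
      zero_lt_one) z ∈ Proj.basicOpen (homogeneousSubmodule (Fin n) k) (X j) ↔
      φ (chartCoord i j) ≠ 0 := by
  have h := Proj.awayι_preimage_basicOpen (homogeneousSubmodule (Fin n) k) (X_mem i) zero_lt_one
    (X_mem j) zero_lt_one
  have h1 : Away.isLocalizationElem (X_mem (k := k) i) (X_mem j) = chartCoord i j := by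
    apply HomogeneousLocalization.val_injective
    simp [chartCoord, Away.val_mk]
  rw [h1] at h
  have h2 : (Spec.map (CommRingCat.ofHom φ)) z ∈ PrimeSpectrum.basicOpen (chartCoord i j) ↔
      φ (chartCoord i j) ≠ 0 := by
    have hz : z.asIdeal = ⊥ := (Ideal.eq_bot_or_top z.asIdeal).resolve_right z.isPrime.ne_top
    change φ (chartCoord i j) ∉ z.asIdeal ↔ _
    rw [hz, Ideal.mem_bot]
  rw [← h2, ← h]
  rfl

theorem exists_mem_basicOpen (x : Proj (homogeneousSubmodule (Fin n) k)) :
    ∃ i, x ∈ Proj.basicOpen (homogeneousSubmodule (Fin n) k) (X i) := by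
  have h := Proj.iSup_basicOpen_eq_top' (homogeneousSubmodule (Fin n) k)
    (X : Fin n → MvPolynomial (Fin n) k) (fun i => ⟨1, X_mem i⟩) (by
      rw [eq_top_iff]
      intro y _
      induction y using MvPolynomial.induction_on with
      | C c =>
        exact Subalgebra.algebraMap_mem (Algebra.adjoin _ _)
          (⟨C c, isHomogeneous_C _ c⟩ : homogeneousSubmodule (Fin n) k 0)
      | add p q hp hq => exact add_mem (hp trivial) (hq trivial)
      | mul_X p i hp => exact mul_mem (hp trivial) (Algebra.subset_adjoin ⟨i, rfl⟩))
  exact TopologicalSpace.Opens.mem_iSup.1 (h.ge (Set.mem_univ x))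

theorem exists_chart_hom {K : Type} [Field K] (g : Spec (.of K) ⟶ Proj (homogeneousSubmodule (Fin n) k)) (i : Fin n)
    (z : Spec (.of K)) (h : g z ∈ Proj.basicOpen (homogeneousSubmodule (Fin n) k) (X i)) :
    ∃ φ : Chart k i →+* K, Spec.map (CommRingCat.ofHom φ) ≫
      Proj.awayι (homogeneousSubmodule (Fin n) k) (X i) (X_mem i) zero_lt_one = g := by
  let ι := Proj.awayι (homogeneousSubmodule (Fin n) k) (X i) (X_mem i) zero_lt_one
  have hr : Set.range g ⊆ Set.range ι := by
    rintro _ ⟨w, rfl⟩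
    obtain rfl : w = z := Subsingleton.elim (α := PrimeSpectrum K) w z
    rw [← Proj.opensRange_awayι _ _ (X_mem i) zero_lt_one] at h
    exact h
  refine ⟨(Spec.preimage (IsOpenImmersion.lift ι g hr)).hom, ?_⟩
  rw [CommRingCat.ofHom_hom, Spec.map_preimage]
  exact IsOpenImmersion.lift_fac ι g hr

/-- Normalized homogeneous coordinates whose first nonzero entry, in position `i`, is `1`. -/
abbrev NormalizedCoord (n : ℕ) (K : Type) [Field K] : Type :=
  Σ i : Fin n, {a : Fin n → K // a i = 1 ∧ ∀ j < i, a j = 0}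

/-- The point of projective space with given normalized homogeneous coordinates. -/
def pointOfCoord {K : Type} [Field K] [Algebra k K] (c : NormalizedCoord n K) :
    Spec (.of K) ⟶ Proj (homogeneousSubmodule (Fin n) k) :=
  Spec.map (CommRingCat.ofHom (chartEval (k := k) c.1 c.2.1 c.2.2.1)) ≫
    Proj.awayι (homogeneousSubmodule (Fin n) k) (X c.1) (X_mem c.1) zero_lt_one

/-- The open sets X_j ≠ 0 containing the image point detect the nonzero coordinates, hence the
position i of the first one; the values of X_j / X_i are then the coordinates. `Subsingleton (k →+*
K)`, valid for k = 𝔽_p, leaves no freedom on constants. -/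
theorem pointOfCoord_bijective {K : Type} [Field K] [Algebra k K] [Subsingleton (k →+* K)] :
    Function.Bijective (pointOfCoord (n := n) (k := k) (K := K)) := by
  have hz : Nonempty (Spec (.of K)) := inferInstanceAs (Nonempty (PrimeSpectrum K))
  obtain ⟨z⟩ := hz
  have hmem (c : NormalizedCoord n K) (j : Fin n) : pointOfCoord (k := k) c z ∈
      Proj.basicOpen (homogeneousSubmodule (Fin n) k) (X j) ↔ c.2.1 j ≠ 0 := by
    rw [pointOfCoord, mem_basicOpen_iff, chartEval_chartCoord]
  have hself (c : NormalizedCoord n K) : c.2.1 c.1 ≠ 0 := by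
    rw [c.2.2.1]; exact one_ne_zero
  constructor
  · intro c c' h
    have h1 (j : Fin n) : c.2.1 j ≠ 0 ↔ c'.2.1 j ≠ 0 := by rw [← hmem c, ← hmem c', h]
    have hi : c.1 = c'.1 := by
      refine le_antisymm (le_of_not_gt fun hlt => ?_) (le_of_not_gt fun hlt => ?_)
      · exact (h1 _).2 (hself c') (c.2.2.2 _ hlt)
      · exact (h1 _).1 (hself c) (c'.2.2.2 _ hlt)
    obtain ⟨i, a, ha⟩ := c
    obtain ⟨i', a', ha'⟩ := c'
    obtain rfl : i = i' := hi
    have h2 := congrArg CommRingCat.Hom.hom (Spec.map_injective ((cancel_mono _).1 h))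
    congr 2
    funext j
    rw [← chartEval_chartCoord (k := k) i a ha.1 j, ← chartEval_chartCoord (k := k) i a' ha'.1 j]
    exact congr($h2 _)
  · intro g
    classical
    let s : Finset (Fin n) := Finset.univ.filter fun i =>
      g z ∈ Proj.basicOpen (homogeneousSubmodule (Fin n) k) (X i)
    have hs : s.Nonempty := by
      obtain ⟨i, hi⟩ := exists_mem_basicOpen (g z)
      exact ⟨i, Finset.mem_filter.2 ⟨Finset.mem_univ _, hi⟩⟩
    -- The least chart containing the point makes all earlier coordinates vanish.
    let i := s.min' hs
    have hi : g z ∈ Proj.basicOpen (homogeneousSubmodule (Fin n) k) (X i) :=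
      (Finset.mem_filter.1 (s.min'_mem hs)).2
    obtain ⟨φ, hφ⟩ := exists_chart_hom g i z hi
    have h1 : φ (chartCoord i i) = 1 := by rw [chartCoord_self, map_one]
    refine ⟨⟨i, fun j => φ (chartCoord i j), h1, fun j hj => ?_⟩, ?_⟩
    · by_contra h
      rw [← ne_eq, ← mem_basicOpen_iff i j φ z, hφ] at h
      exact (s.min'_le j (Finset.mem_filter.2 ⟨Finset.mem_univ _, h⟩)).not_gt hj
    · refine Eq.trans ?_ hφ
      refine congrArg (fun ψ => Spec.map (CommRingCat.ofHom ψ) ≫ Proj.awayι _ _ (X_mem i) _) ?_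
      exact chart_hom_ext i fun j => chartEval_chartCoord i _ h1 j

/-- A leading 1 in position i leaves n - 1 - i free coordinates. -/
theorem natCard_normalizedCoord (K : Type) [Field K] [Finite K] :
    Nat.card (NormalizedCoord n K) = ∑ l ∈ Finset.range n, Nat.card K ^ l := by
  classical
  have := Fintype.ofFinite K
  rw [Nat.card_sigma, ← Finset.sum_range_reflect,
    ← Fin.sum_univ_eq_sum_range fun l : ℕ => Nat.card K ^ (n - 1 - l)]
  refine Finset.sum_congr rfl fun i _ => ?_
  let s : Fin n → Finset K := fun j => if j < i then {0} else if j = i then {1} else Finset.univ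
  have hs (a : Fin n → K) : a ∈ Fintype.piFinset s ↔ a i = 1 ∧ ∀ j < i, a j = 0 := by
    rw [Fintype.mem_piFinset]
    constructor
    · intro h
      exact ⟨by simpa [s] using h i, fun j hj => by simpa [s, hj] using h j⟩
    · rintro ⟨h1, h2⟩ j
      rcases lt_trichotomy j i with h | rfl | h
      · simp [s, h, h2 j h]
      · simp [s, h1]
      · simp [s, h.not_gt, h.ne']
  rw [Nat.card_congr (Equiv.subtypeEquivRight fun a => (hs a).symm), Nat.card_eq_fintype_card,
    Fintype.card_coe, Fintype.card_piFinset]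
  have hc (j : Fin n) : (s j).card = if i < j then Nat.card K else 1 := by
    rcases lt_trichotomy j i with h | rfl | h
    · simp [s, h, h.not_gt]
    · simp [s]
    · simp [s, h, h.not_gt, h.ne', Nat.card_eq_fintype_card]
  simp_rw [hc]
  rw [Finset.prod_ite]
  have h : (Finset.univ.filter fun j => i < j) = Finset.Ioi i := by ext; simp
  simp [h, Fin.card_Ioi]

theorem algebraMap_homogeneousSubmodule_zero_surjective :
    Function.Surjective (algebraMap k (homogeneousSubmodule (Fin n) k 0)) := by
  rintro ⟨y, hy⟩
  refine ⟨coeff 0 y, Subtype.ext ?_⟩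
  have h : y.totalDegree = 0 :=
    Nat.le_zero.1 (IsHomogeneous.totalDegree_le ((mem_homogeneousSubmodule 0 y).1 hy))
  exact (totalDegree_eq_zero_iff_eq_C.1 h).symm

instance locallyOfFiniteType_projectiveSpaceStr :
    LocallyOfFiniteType (projectiveSpaceStr n k) := by
  have : IsScalarTower k (homogeneousSubmodule (Fin n) k 0) (MvPolynomial (Fin n) k) :=
    IsScalarTower.of_algebraMap_eq (R := k) (S := homogeneousSubmodule (Fin n) k 0)
      (A := MvPolynomial (Fin n) k) fun _ => rfl
  have : Algebra.FiniteType (homogeneousSubmodule (Fin n) k 0) (MvPolynomial (Fin n) k) :=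
    Algebra.FiniteType.of_restrictScalars_finiteType k _ _
  have : LocallyOfFiniteType (Spec.map (CommRingCat.ofHom
      (algebraMap k (homogeneousSubmodule (Fin n) k 0)))) := by
    rw [HasRingHomProperty.Spec_iff (P := @LocallyOfFiniteType)]
    exact RingHom.FiniteType.of_surjective _ algebraMap_homogeneousSubmodule_zero_surjective
  have h : LocallyOfFiniteType (Proj.toSpecZero (homogeneousSubmodule (Fin n) k)) := inferInstance
  exact MorphismProperty.comp_mem @LocallyOfFiniteType _ _ h this

theorem natCard_rationalPoint_projectiveSpace (p : ℕ) [Fact p.Prime] (n : ℕ) {m : ℕ} (hm : m ≠ 0) :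
    Finite (RationalPoint (projectiveSpaceStr n (ZMod p)) m) ∧
    Nat.card (RationalPoint (projectiveSpaceStr n (ZMod p)) m) =
      ∑ l ∈ Finset.range n, (p ^ m) ^ l := by
  have : Finite (GaloisField p m) := inferInstance
  let e : RationalPoint (projectiveSpaceStr n (ZMod p)) m ≃ NormalizedCoord n (GaloisField p m) :=
    ((rationalPointEquiv _ m).trans (Scheme.SpecToEquivOfField (GaloisField p m) _).symm).trans
      (Equiv.ofBijective _ (pointOfCoord_bijective (k := ZMod p))).symm
  refine ⟨Finite.of_equiv _ e.symm, ?_⟩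
  rw [Nat.card_congr e, natCard_normalizedCoord, GaloisField.card p m hm]

end Points

end ZetaEntropy

end

/-! ### Differentiating the series and evaluating the zeta function. -/

noncomputable section

namespace ZetaEntropy

/-- Termwise differentiation of a Dirichlet series with frequencies `deg α * log p`. -/
theorem exists_hasDerivAt_of_hasSum {ι : Type*} (deg : ι → ℕ) {p : ℝ} (hp : 1 < p) {c : ℝ}
    {Z : ℝ → ℝ} (hZ : ∀ b, c < b → HasSum (fun α => (p ^ (-b)) ^ deg α) (Z b)) {s : ℝ}
    (hs : c < s) :
    ∃ E, HasSum (fun α => deg α * Real.log p * (p ^ (-s)) ^ deg α) E ∧ HasDerivAt Z (-E) s := by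
  have hp0 : 0 < p := zero_lt_one.trans hp
  have hlog : 0 < Real.log p := Real.log_pos hp
  -- With c < s₁ < s₀ < s, the series at s₁ is a convergent majorant on b > s₀: the gap s₀ - s₁
  -- absorbs the factor deg α * log p through x ≤ exp x.
  obtain ⟨s₀, hc0, h0s⟩ := exists_between hs
  obtain ⟨s₁, hc1, h10⟩ := exists_between hc0
  have hpow (b : ℝ) (m : ℕ) : (p ^ (-b)) ^ m = Real.exp (-(b * (m * Real.log p))) := by
    rw [Real.rpow_def_of_pos hp0, ← Real.exp_nat_mul]
    ring_nf
  have hd (α : ι) (b : ℝ) : HasDerivAt (fun b => (p ^ (-b)) ^ deg α)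
      (-(deg α * Real.log p * (p ^ (-b)) ^ deg α)) b := by
    simp_rw [hpow]
    have h : HasDerivAt (fun b : ℝ => Real.exp (-(b * (deg α * Real.log p))))
        (Real.exp (-(b * (deg α * Real.log p))) * -(1 * (deg α * Real.log p))) b :=
      ((hasDerivAt_id b).mul_const (deg α * Real.log p)).neg.exp
    exact h.congr_deriv (by ring)
  have hu : Summable fun α => (s₀ - s₁)⁻¹ * (p ^ (-s₁)) ^ deg α :=
    (hZ s₁ hc1).summable.mul_left _
  have hb (α : ι) (b : ℝ) (hb : b ∈ Set.Ioi s₀) :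
      ‖-(deg α * Real.log p * (p ^ (-b)) ^ deg α)‖ ≤ (s₀ - s₁)⁻¹ * (p ^ (-s₁)) ^ deg α := by
    rw [norm_neg, Real.norm_of_nonneg (by positivity), inv_mul_eq_div, le_div_iff₀ (sub_pos.2 h10)]
    rw [hpow, hpow]
    have hm : 0 ≤ deg α * Real.log p := by positivity
    have h1 : (s₀ - s₁) * (deg α * Real.log p) ≤ Real.exp ((s₀ - s₁) * (deg α * Real.log p)) := by
      linarith [Real.add_one_le_exp ((s₀ - s₁) * (deg α * Real.log p))]
    have h2 : Real.exp (-(b * (deg α * Real.log p))) ≤ Real.exp (-(s₀ * (deg α * Real.log p))) :=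
      Real.exp_le_exp.2 (neg_le_neg (mul_le_mul_of_nonneg_right (le_of_lt hb) hm))
    calc _ = ((s₀ - s₁) * (deg α * Real.log p)) * Real.exp (-(b * (deg α * Real.log p))) := by ring
      _ ≤ Real.exp ((s₀ - s₁) * (deg α * Real.log p)) * Real.exp (-(s₀ * (deg α * Real.log p))) :=
        mul_le_mul h1 h2 (Real.exp_pos _).le (Real.exp_pos _).le
      _ = _ := by rw [← Real.exp_add]; ring_nf
  have hder := hasDerivAt_tsum_of_isPreconnected hu isOpen_Ioi isPreconnected_Ioi
    (fun α b _ => hd α b) hb (Set.mem_Ioi.2 h0s) (hZ s hs).summable (Set.mem_Ioi.2 h0s)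
  have hsum : Summable fun α => deg α * Real.log p * (p ^ (-s)) ^ deg α := by
    have := Summable.of_norm_bounded hu fun α => hb α s h0s
    simpa using this.neg
  refine ⟨_, hsum.hasSum, ?_⟩
  rw [tsum_neg] at hder
  refine hder.congr_of_eventuallyEq ?_
  filter_upwards [Ioi_mem_nhds hs] with b hb
  exact (hZ b hb).tsum_eq.symm

section

variable (p : ℕ) [hp : Fact p.Prime] (n : ℕ)

/-- The zeta function of projective space, as a function of `s`. -/
def zetaProd (s : ℝ) : ℝ := ∏ l ∈ Finset.range n, (1 - (p : ℝ) ^ ((l : ℝ) - s))⁻¹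

variable {p n} {s : ℝ}

theorem rpow_sub_eq (l : ℕ) : (p : ℝ) ^ ((l : ℝ) - s) = (p : ℝ) ^ l * (p : ℝ) ^ (-s) := by
  have h : (0 : ℝ) < p := by exact_mod_cast hp.out.pos
  rw [sub_eq_add_neg, Real.rpow_add h, Real.rpow_natCast]

theorem rpow_sub_lt_one (hs : (n : ℝ) - 1 < s) {l : ℕ} (hl : l < n) :
    (p : ℝ) ^ ((l : ℝ) - s) < 1 := by
  have h : (1 : ℝ) < p := by exact_mod_cast hp.out.one_lt
  have h1 : (l : ℝ) + 1 ≤ n := by exact_mod_cast hl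
  exact Real.rpow_lt_one_of_one_lt_of_neg h (by linarith)

theorem zetaProd_pos (hs : (n : ℝ) - 1 < s) : 0 < zetaProd p n s :=
  Finset.prod_pos fun _ hl =>
    inv_pos.2 (sub_pos.2 (rpow_sub_lt_one hs (Finset.mem_range.1 hl)))

theorem hasSum_degeneracy (hs : (n : ℝ) - 1 < s) :
    HasSum (fun k : ℕ => (degeneracy n p k : ℝ) * Real.exp (-(s * level p k)))
      (zetaProd p n s) := by
  have h : (0 : ℝ) < p := by exact_mod_cast hp.out.pos
  have h1 := hasSum_degeneracy_mul_pow p n (x := (p : ℝ) ^ (-s)) (by positivity)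
    fun l hl => by rw [← rpow_sub_eq]; exact rpow_sub_lt_one hs hl
  simp_rw [← rpow_sub_eq] at h1
  rw [zetaProd]
  convert h1 using 3 with k
  rw [Real.rpow_def_of_pos h, ← Real.exp_nat_mul, level]
  ring_nf

/-- The point count turns the m-th term into ∑_l (p^{l-s})^m / m, a sum of n series for -log(1 -
p^{l-s}). -/
theorem hasSum_logZeta (hs : (n : ℝ) - 1 < s) :
    HasSum (fun m : ℕ => (Nat.card (RationalPoint (projectiveSpaceStr n (ZMod p)) (m + 1)) : ℝ) *
      ((p : ℝ) ^ (-s)) ^ (m + 1) / ((m : ℝ) + 1)) (Real.log (zetaProd p n s)) := by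
  have h : (0 : ℝ) < p := by exact_mod_cast hp.out.pos
  have hl (l) (hl : l ∈ Finset.range n) := Real.hasSum_pow_div_log_of_abs_lt_one
    (x := (p : ℝ) ^ ((l : ℝ) - s)) (by
      rw [abs_of_nonneg (by positivity)]
      exact rpow_sub_lt_one hs (Finset.mem_range.1 hl))
  have h1 := hasSum_sum hl
  have h2 : ∑ l ∈ Finset.range n, -Real.log (1 - (p : ℝ) ^ ((l : ℝ) - s)) =
      Real.log (zetaProd p n s) := by
    rw [zetaProd, Real.log_prod fun l hl => (inv_pos.2 (sub_pos.2
      (rpow_sub_lt_one hs (Finset.mem_range.1 hl)))).ne']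
    simp_rw [Real.log_inv]
  rw [h2] at h1
  convert h1 using 2 with m
  rw [(natCard_rationalPoint_projectiveSpace p n m.succ_ne_zero).2, ← Finset.sum_div]
  congr 1
  push_cast
  rw [Finset.sum_mul]
  refine Finset.sum_congr rfl fun l _ => ?_
  rw [rpow_sub_eq, mul_pow, ← pow_mul, ← pow_mul, mul_comm l]

theorem hasseWeilZeta_projectiveSpace (hs : (n : ℝ) - 1 < s) :
    hasseWeilZeta (projectiveSpaceStr n (ZMod p)) ((p : ℝ) ^ (-s)) = zetaProd p n s := by
  rw [hasseWeilZeta, (hasSum_logZeta hs).tsum_eq, Real.exp_log (zetaProd_pos hs)]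

theorem hasSum_cycleDegree (hn : 1 ≤ n) (hs : (n : ℝ) - 1 < s) :
    HasSum (fun α : EffectiveZeroCycle (projectiveSpace n (ZMod p)) =>
      ((p : ℝ) ^ (-s)) ^ cycleDegree (projectiveSpaceStr n (ZMod p)) α) (zetaProd p n s) := by
  -- This is the factor l = 0, available because n ≥ 1.
  have ht : (p : ℝ) ^ (-s) < 1 := by simpa using rpow_sub_lt_one (p := p) hs hn
  have := hasSum_pow_degree
    (fun x : ClosedPoint (projectiveSpace n (ZMod p)) =>
      (projectiveSpaceStr n (ZMod p)).residueDegree x.1)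
    (fun x => residueDegree_pos _ x.2)
    (fun m => Nat.card (RationalPoint (projectiveSpaceStr n (ZMod p)) m))
    (fun m hm => hasSum_residueDegree _ hm.ne'
      (natCard_rationalPoint_projectiveSpace p n hm.ne').1)
    (by positivity) ht (hasSum_logZeta hs)
  rwa [Real.exp_log (zetaProd_pos hs)] at this

end

end ZetaEntropy

end

/-! ### Comparison of the two entropies. -/

theorem lemma6p2p4 (p : ℕ) [Fact p.Prime] (n : ℕ) (hn : 1 ≤ n) (s : ℝ) (hs : (n : ℝ) - 1 < s) :
    (∀ k : ℕ, (ZetaEntropy.reducedMatrices n ((p : ℤ) ^ k)).Finite) ∧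
    HasSum (fun k : ℕ => (ZetaEntropy.degeneracy n p k : ℝ) *
        Real.exp (-(s * ZetaEntropy.level p k)))
      (∏ l ∈ Finset.range n, (1 - (p : ℝ) ^ ((l : ℝ) - s))⁻¹) ∧
    ZetaEntropy.hasseWeilZeta (ZetaEntropy.projectiveSpaceStr n (ZMod p)) ((p : ℝ) ^ (-s)) =
      ∏ l ∈ Finset.range n, (1 - (p : ℝ) ^ ((l : ℝ) - s))⁻¹ ∧
    HasSum (ZetaEntropy.cycleProb (ZetaEntropy.projectiveSpaceStr n (ZMod p)) s) 1 ∧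
    Summable (fun α : ZetaEntropy.EffectiveZeroCycle (ZetaEntropy.projectiveSpace n (ZMod p)) =>
      ZetaEntropy.cycleProb (ZetaEntropy.projectiveSpaceStr n (ZMod p)) s α *
        Real.log (ZetaEntropy.cycleProb (ZetaEntropy.projectiveSpaceStr n (ZMod p)) s α)) ∧
    DifferentiableAt ℝ (fun b => Real.log (ZetaEntropy.partitionFunction
      (ZetaEntropy.level p) (ZetaEntropy.degeneracy n p) b)) s ∧
    ZetaEntropy.shannonEntropy (ZetaEntropy.projectiveSpaceStr n (ZMod p)) s =
      ZetaEntropy.thermoEntropy (ZetaEntropy.level p) (ZetaEntropy.degeneracy n p) s := by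
  have hp : (1 : ℝ) < p := by exact_mod_cast (Fact.out : p.Prime).one_lt
  have hp0 : (0 : ℝ) < p := zero_lt_one.trans hp
  have hZ := ZetaEntropy.zetaProd_pos (p := p) hs
  have hHW := ZetaEntropy.hasseWeilZeta_projectiveSpace (p := p) hs
  have hcyc := ZetaEntropy.hasSum_cycleDegree (p := p) hn hs
  obtain ⟨E, hE, hder⟩ := ZetaEntropy.exists_hasDerivAt_of_hasSum
    (ZetaEntropy.cycleDegree (ZetaEntropy.projectiveSpaceStr n (ZMod p))) hp
    (fun b hb => ZetaEntropy.hasSum_cycleDegree (p := p) hn hb) hs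
  have hpart (b : ℝ) (hb : (n : ℝ) - 1 < b) : ZetaEntropy.partitionFunction
      (ZetaEntropy.level p) (ZetaEntropy.degeneracy n p) b = ZetaEntropy.zetaProd p n b :=
    (ZetaEntropy.hasSum_degeneracy hb).tsum_eq
  have hlog : HasDerivAt (fun b => Real.log (ZetaEntropy.partitionFunction
      (ZetaEntropy.level p) (ZetaEntropy.degeneracy n p) b)) (-E / ZetaEntropy.zetaProd p n s) s := by
    -- The partition function is identified with the product only for b > n - 1, which is a
    -- neighbourhood of s.
    refine (hder.log hZ.ne').congr_of_eventuallyEq ?_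
    filter_upwards [Ioi_mem_nhds hs] with b hb
    rw [hpart b hb]
  have hent : HasSum (fun α : ZetaEntropy.EffectiveZeroCycle
      (ZetaEntropy.projectiveSpace n (ZMod p)) =>
      ZetaEntropy.cycleProb (ZetaEntropy.projectiveSpaceStr n (ZMod p)) s α *
        Real.log (ZetaEntropy.cycleProb (ZetaEntropy.projectiveSpaceStr n (ZMod p)) s α))
      (-(s * (E / ZetaEntropy.zetaProd p n s)) - Real.log (ZetaEntropy.zetaProd p n s)) := by
    -- Termwise, P log P = -s · (deg α · log p) · P - P · log Z; here E / Z is the mean energy and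
    -- the weights sum to 1.
    have h1 := ((hE.div_const (ZetaEntropy.zetaProd p n s)).mul_left s).neg.sub
      ((hcyc.div_const (ZetaEntropy.zetaProd p n s)).mul_right
        (Real.log (ZetaEntropy.zetaProd p n s)))
    rw [div_self hZ.ne', one_mul] at h1
    convert! h1 using 2 with α
    rw [ZetaEntropy.cycleProb, hHW, Real.log_div (by positivity) hZ.ne', Real.log_pow,
      Real.log_rpow hp0]
    ring
  refine ⟨fun k => ?_, ZetaEntropy.hasSum_degeneracy hs, hHW, ?_, hent.summable,
    hlog.differentiableAt, ?_⟩
  · rw [ZetaEntropy.reducedMatrices_eq_biUnion]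
    exact Finset.finite_toSet _
  · have h1 := hcyc.div_const (ZetaEntropy.zetaProd p n s)
    rw [div_self hZ.ne', ← hHW] at h1
    exact h1
  · rw [ZetaEntropy.shannonEntropy, hent.tsum_eq, ZetaEntropy.thermoEntropy, hlog.deriv, hpart s hs]
    ring
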